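/- Let $(\Omega,\mu)$ be an atomless finite measure space. An exponent is a measurable function $p:\Omega\to[1,\infty)$; $p^+$ denotes its essential supremum. For an exponent $p(\cdot)$, the variable Lebesgue space $L^{p(\cdot)}(\mu)$ is the space of all classes (modulo $\mu$-a.e. equality) of real measurable functions $f$ on $\Omega$ with $\rho_{p(\cdot)}(f/r)<\infty$ for some $r>0$, where $\rho_{p(\cdot)}(f)=\int_\Omega|f(t)|^{p(t)}\,d\mu$, with the Luxemburg norm $\|f\|_{p(\cdot)}=\inf\{r>0:\rho_{p(\cdot)}(f/r)\le 1\}$. For a measurable function $f$ on $\Omega$, its decreasing rearrangement is $f^*(x)=\inf\{s\ge 0:\mu(\{t\in\Omega:|f(t)|>s\})\le x\}$ for $x\in[0,\mu(\Omega))$. A sequence of functions is disjoint if any two different members have a.e. disjoint supports. **Theorem 4.1.** Let $p(\cdot),q(\cdot)$ be exponents on $\Omega$ with $q(\cdot)<p(\cdot)$ $\mu$-a.e. and $q^+<\infty$, and let $i:L^{p(\cdot)}(\mu)\hookrightarrow L^{q(\cdot)}(\mu)$ be the inclusion. The following are equivalent: 1. $\int_0^{\mu(\Omega)}a^{\left(\frac{p}{p-q}\right)^*(x)}\,dx<\infty$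 for every $a>1$. 2. $i$ is L-weakly compact: for every sequence $(A_n)$ of measurable sets with $\chi_{A_n}\to0$ $\mu$-a.e., $\lim_{n\to\infty}\sup\{\|f\chi_{A_n}\|_{q(\cdot)}:\|f\|_{p(\cdot)}\le1\}=0$. 3. $i$ is M-weakly compact: $\|f_n\|_{q(\cdot)}\to0$ for every norm bounded disjoint sequence $(f_n)$ in $L^{p(\cdot)}(\mu)$. 4. $i$ is disjointly strictly singular (DSS): for every disjoint sequence $(f_n)$ in $L^{p(\cdot)}(\mu)$ with $\|f_n\|_{p(\cdot)}=1$ for all $n$, the restriction of $i$ to the closed linear span $[f_n]$ of $(f_n)$ in $L^{p(\cdot)}(\mu)$ is not an isomorphism onto its image, i.e. there is no $c>0$ with $\|f\|_{q(\cdot)}\ge c\|f\|_{p(\cdot)}$ for all $f\in[f_n]$. 5. For every sequence $(E_n)$ of pairwise disjoint measurable sets with $\mu(E_n)>0$, the restriction of $i$ to the closed linear span in $L^{p(\cdot)}(\mu)$ of the functions $t\mapsto\chi_{E_n}(t)/\mu(E_n)^{1/p(t)}$ is not an isomorphism onto its image. 6. $\lim_{x\to\mu(\Omega)^-}(\mu(\Omega)-x)^{\left(\frac{p-q}{p}\right)^*(x)}=0$,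 where $x$ ranges over $[0,\mu(\Omega))$. -/

import Mathlib

open MeasureTheory Set Filter Topology
open scoped ENNReal

noncomputable section

/-- A measure is *atomless* if every measurable set of positive measure contains a measurable
subset of strictly smaller positive measure. -/
def Atomless {Ω : Type*} [MeasurableSpace Ω] (μ : Measure Ω) : Prop :=
  ∀ A : Set Ω, MeasurableSet A → 0 < μ A → ∃ B ⊆ A, MeasurableSet B ∧ 0 < μ B ∧ μ B < μ A

/-- An *exponent* on `Ω`: a real measurable function `p` with `1 ≤ p(t) < ∞`. -/
structure VarExponent (Ω : Type*) [MeasurableSpace Ω] where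
  toFun : Ω → ℝ
  measurable' : Measurable toFun
  one_le' : ∀ t, 1 ≤ toFun t

namespace VarExponent

variable {Ω : Type*} [MeasurableSpace Ω]

instance : CoeFun (VarExponent Ω) (fun _ => Ω → ℝ) := ⟨VarExponent.toFun⟩

theorem measurable (p : VarExponent Ω) : Measurable (p : Ω → ℝ) := p.measurable'

theorem one_le (p : VarExponent Ω) (t : Ω) : 1 ≤ p t := p.one_le' t

theorem pos (p : VarExponent Ω) (t : Ω) : 0 < p t := lt_of_lt_of_le one_pos (p.one_le t)

/-- `p⁺`, the essential supremum of the exponent, as an extended nonnegative number. -/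
def plus (p : VarExponent Ω) (μ : Measure Ω) : ℝ≥0∞ := essSup (fun t => ENNReal.ofReal (p t)) μ

end VarExponent

section Modular

variable {Ω : Type*} [MeasurableSpace Ω]

/-- The modular `ρ_{p(·)}(f) = ∫ |f(t)|^{p(t)} dμ`. -/
def modular (p : VarExponent Ω) (μ : Measure Ω) (f : Ω → ℝ) : ℝ≥0∞ :=
  ∫⁻ t, ENNReal.ofReal (|f t| ^ p t) ∂μ

/-- The Luxemburg norm `‖f‖_{p(·)} = inf {r > 0 : ρ_{p(·)}(f / r) ≤ 1}`. -/
def luxNorm (p : VarExponent Ω) (μ : Measure Ω) (f : Ω → ℝ) : ℝ :=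
  sInf {r : ℝ | 0 < r ∧ modular p μ (fun t => f t / r) ≤ 1}

/-- The modular of `f / r` is finite for some `r > 0`. -/
def MemVLp (p : VarExponent Ω) (μ : Measure Ω) (f : Ω → ℝ) : Prop :=
  ∃ r : ℝ, 0 < r ∧ modular p μ (fun t => f t / r) < ∞

variable {p q : VarExponent Ω} {μ : Measure Ω} {f g : Ω → ℝ}

theorem modular_congr (h : f =ᵐ[μ] g) : modular p μ f = modular p μ g := by
  refine lintegral_congr_ae ?_
  filter_upwards [h] with t ht
  rw [ht]

theorem modular_div_congr (h : f =ᵐ[μ] g) (r : ℝ) :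
    modular p μ (fun t => f t / r) = modular p μ (fun t => g t / r) := by
  refine modular_congr ?_
  filter_upwards [h] with t ht
  rw [ht]

theorem luxNorm_congr (h : f =ᵐ[μ] g) : luxNorm p μ f = luxNorm p μ g := by
  unfold luxNorm
  simp only [modular_div_congr h]

theorem MemVLp.congr (hf : MemVLp p μ f) (h : f =ᵐ[μ] g) : MemVLp p μ g := by
  obtain ⟨r, hr, hfr⟩ := hf
  exact ⟨r, hr, by rwa [← modular_div_congr h]⟩

theorem modular_mono (h : ∀ᵐ t ∂μ, |f t| ≤ |g t|) : modular p μ f ≤ modular p μ g := by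
  refine lintegral_mono_ae ?_
  filter_upwards [h] with t ht
  exact ENNReal.ofReal_le_ofReal (Real.rpow_le_rpow (abs_nonneg _) ht (p.pos t).le)

theorem MemVLp.mono (hg : MemVLp p μ g) (h : ∀ᵐ t ∂μ, |f t| ≤ |g t|) : MemVLp p μ f := by
  obtain ⟨r, hr, hgr⟩ := hg
  refine ⟨r, hr, lt_of_le_of_lt (modular_mono ?_) hgr⟩
  filter_upwards [h] with t ht
  rw [abs_div, abs_div]
  gcongr

/-- Convexity of the modular in the scalar variable. -/
theorem modular_smul_le {θ : ℝ} (h0 : 0 ≤ θ) (h1 : θ ≤ 1) (f : Ω → ℝ) :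
    modular p μ (fun t => θ * f t) ≤ ENNReal.ofReal θ * modular p μ f := by
  unfold modular
  rw [← lintegral_const_mul' _ _ ENNReal.ofReal_ne_top]
  refine lintegral_mono fun t => ?_
  rw [← ENNReal.ofReal_mul h0]
  refine ENNReal.ofReal_le_ofReal ?_
  rw [abs_mul, abs_of_nonneg h0, Real.mul_rpow h0 (abs_nonneg _)]
  gcongr
  calc θ ^ p t ≤ θ ^ (1 : ℝ) := Real.rpow_le_rpow_of_exponent_ge' h0 h1 zero_le_one (p.one_le t)
    _ = θ := Real.rpow_one θ

/-- Convexity of the modular. -/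
theorem modular_convex {a b : ℝ} (ha : 0 ≤ a) (hb : 0 ≤ b) (hab : a + b = 1)
    (hf : AEMeasurable f μ) (g : Ω → ℝ) :
    modular p μ (fun t => a * f t + b * g t) ≤
      ENNReal.ofReal a * modular p μ f + ENNReal.ofReal b * modular p μ g := by
  unfold modular
  rw [← lintegral_const_mul' _ _ ENNReal.ofReal_ne_top,
    ← lintegral_const_mul' _ _ ENNReal.ofReal_ne_top, ← lintegral_add_left']
  · refine lintegral_mono fun t => ?_
    rw [← ENNReal.ofReal_mul ha, ← ENNReal.ofReal_mul hb, ← ENNReal.ofReal_add (by positivity)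
      (by positivity)]
    refine ENNReal.ofReal_le_ofReal ?_
    have h1 : |a * f t + b * g t| ≤ a * |f t| + b * |g t| := by
      refine (abs_add_le _ _).trans ?_
      rw [abs_mul, abs_mul, abs_of_nonneg ha, abs_of_nonneg hb]
    refine (Real.rpow_le_rpow (abs_nonneg _) h1 (p.pos t).le).trans ?_
    exact (convexOn_rpow (p.one_le t)).2 (abs_nonneg (f t)) (abs_nonneg (g t)) ha hb hab
  · have := p.measurable
    exact (((hf.norm).pow this.aemeasurable).ennreal_ofReal).const_mul _

theorem luxNorm_nonneg : 0 ≤ luxNorm p μ f := Real.sInf_nonneg fun _ h => h.1.le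

theorem luxNorm_le {r : ℝ} (hr : 0 < r) (h : modular p μ (fun t => f t / r) ≤ 1) :
    luxNorm p μ f ≤ r := csInf_le ⟨0, fun _ h => h.1.le⟩ ⟨hr, h⟩

theorem MemVLp.nonempty (hf : MemVLp p μ f) :
    {r : ℝ | 0 < r ∧ modular p μ (fun t => f t / r) ≤ 1}.Nonempty := by
  obtain ⟨r, hr, hfr⟩ := hf
  set C := (modular p μ (fun t => f t / r)).toReal with hC
  set K := max 1 C with hK
  have hK1 : 1 ≤ K := le_max_left _ _
  have hK0 : 0 < K := one_pos.trans_le hK1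
  refine ⟨K * r, by positivity, ?_⟩
  have h1 : (fun t => f t / (K * r)) = fun t => K⁻¹ * (f t / r) := by
    funext t; field_simp
  rw [h1]
  refine (modular_smul_le (by positivity) (inv_le_one_of_one_le₀ hK1) _).trans ?_
  rw [← ENNReal.ofReal_toReal hfr.ne, ← ENNReal.ofReal_mul (by positivity), ← hC,
    ENNReal.ofReal_le_one, inv_mul_le_one₀ hK0]
  exact le_max_right _ _

theorem MemVLp.modular_le_one (hf : MemVLp p μ f) {r : ℝ} (h : luxNorm p μ f < r) :
    modular p μ (fun t => f t / r) ≤ 1 := by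
  obtain ⟨s, ⟨hs, hfs⟩, hsr⟩ := exists_lt_of_csInf_lt hf.nonempty h
  refine (modular_mono (.of_forall fun t => ?_)).trans hfs
  rw [abs_div, abs_div, abs_of_pos hs, abs_of_pos (hs.trans hsr)]
  gcongr

theorem modular_add_div_le {r s : ℝ} (hr : 0 < r) (hs : 0 < s) (hf : AEMeasurable f μ) :
    modular p μ (fun t => (f t + g t) / (r + s)) ≤
      ENNReal.ofReal (r / (r + s)) * modular p μ (fun t => f t / r) +
        ENNReal.ofReal (s / (r + s)) * modular p μ (fun t => g t / s) := by
  have h1 : (fun t => (f t + g t) / (r + s)) =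
      fun t => r / (r + s) * (f t / r) + s / (r + s) * (g t / s) := by
    funext t; field_simp
  rw [h1]
  exact modular_convex (by positivity) (by positivity) (by field_simp) (hf.div_const r) _

theorem luxNorm_add_le (hf : MemVLp p μ f) (hg : MemVLp p μ g) (hfm : AEMeasurable f μ) :
    luxNorm p μ (fun t => f t + g t) ≤ luxNorm p μ f + luxNorm p μ g := by
  refine le_of_forall_pos_le_add fun ε hε => ?_
  set r := luxNorm p μ f + ε / 2 with hr
  set s := luxNorm p μ g + ε / 2 with hs
  have hr0 : 0 < r := by have := luxNorm_nonneg (p := p) (μ := μ) (f := f); positivity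
  have hs0 : 0 < s := by have := luxNorm_nonneg (p := p) (μ := μ) (f := g); positivity
  have h : luxNorm p μ (fun t => f t + g t) ≤ r + s := by
    refine luxNorm_le (by positivity) ((modular_add_div_le hr0 hs0 hfm).trans ?_)
    calc _ ≤ ENNReal.ofReal (r / (r + s)) * 1 + ENNReal.ofReal (s / (r + s)) * 1 := by
          gcongr
          · exact hf.modular_le_one (by rw [hr]; linarith)
          · exact hg.modular_le_one (by rw [hs]; linarith)
      _ = 1 := by
          rw [mul_one, mul_one, ← ENNReal.ofReal_add (by positivity) (by positivity),
            ← ENNReal.ofReal_one]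
          congr 1
          field_simp
  calc _ ≤ r + s := h
    _ = _ := by rw [hr, hs]; ring

theorem MemVLp.add (hf : MemVLp p μ f) (hg : MemVLp p μ g) (hfm : AEMeasurable f μ) :
    MemVLp p μ (fun t => f t + g t) := by
  obtain ⟨r, hr, hfr⟩ := hf
  obtain ⟨s, hs, hgs⟩ := hg
  refine ⟨r + s, by positivity, (modular_add_div_le hr hs hfm).trans_lt ?_⟩
  exact ENNReal.add_lt_top.2 ⟨ENNReal.mul_lt_top ENNReal.ofReal_lt_top hfr,
    ENNReal.mul_lt_top ENNReal.ofReal_lt_top hgs⟩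

theorem MemVLp.const_mul (hf : MemVLp p μ f) (c : ℝ) : MemVLp p μ (fun t => c * f t) := by
  obtain ⟨r, hr, hfr⟩ := hf
  refine ⟨(|c| + 1) * r, by positivity, lt_of_le_of_lt (modular_mono (.of_forall fun t => ?_)) hfr⟩
  have : 0 < |c| + 1 := by positivity
  rw [abs_div, abs_div, abs_mul, abs_mul, abs_of_pos this, mul_div_mul_comm]
  have h1 : |c| / (|c| + 1) ≤ 1 := by rw [div_le_one this]; linarith
  exact mul_le_of_le_one_left (by positivity) h1

theorem memVLp_zero : MemVLp p μ (fun _ => 0) := by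
  refine ⟨1, one_pos, ?_⟩
  have : ∀ t, (0 : ℝ) ^ p t = 0 := fun t => Real.zero_rpow (p.pos t).ne'
  simp [modular, this]

theorem luxNorm_const_mul_le (hf : MemVLp p μ f) (c : ℝ) :
    luxNorm p μ (fun t => c * f t) ≤ |c| * luxNorm p μ f := by
  have key : ∀ r, luxNorm p μ f < r → luxNorm p μ (fun t => c * f t) ≤ |c| * r := by
    intro r hr
    have hr0 : 0 < r := luxNorm_nonneg.trans_lt hr
    by_cases hc : c = 0
    · subst hc
      refine le_of_forall_pos_le_add fun ε hε => ?_
      have h : ∀ t, (0 : ℝ) ^ p t = 0 := fun t => Real.zero_rpow (p.pos t).ne'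
      refine (luxNorm_le hε ?_).trans (by simp)
      simp [modular, h]
    · have hc0 : 0 < |c| := abs_pos.2 hc
      refine luxNorm_le (by positivity) ((modular_mono (.of_forall fun t => ?_)).trans
        (hf.modular_le_one hr))
      rw [abs_div, abs_div, abs_mul, abs_mul, abs_abs, mul_div_mul_left _ _ hc0.ne']
  refine le_of_forall_pos_le_add fun ε hε => ?_
  refine (key (luxNorm p μ f + ε / (|c| + 1)) (lt_add_of_pos_right _ (by positivity))).trans ?_
  rw [mul_add]
  gcongr
  rw [mul_div_assoc', div_le_iff₀ (by positivity)]
  nlinarith [abs_nonneg c]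

theorem luxNorm_const_mul (hf : MemVLp p μ f) (c : ℝ) :
    luxNorm p μ (fun t => c * f t) = |c| * luxNorm p μ f := by
  refine le_antisymm (luxNorm_const_mul_le hf c) ?_
  by_cases hc : c = 0
  · subst hc
    simpa using luxNorm_nonneg
  · have h := luxNorm_const_mul_le (hf.const_mul c) c⁻¹
    have h1 : (fun t => c⁻¹ * (c * f t)) = f := by funext t; field_simp
    rw [h1, abs_inv] at h
    have hc0 : 0 < |c| := abs_pos.2 hc
    calc |c| * luxNorm p μ f ≤ |c| * (|c|⁻¹ * luxNorm p μ (fun t => c * f t)) := by gcongr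
      _ = _ := by field_simp

theorem ae_eq_zero_of_luxNorm (hf : MemVLp p μ f) (hfm : AEMeasurable f μ)
    (h : luxNorm p μ f = 0) : f =ᵐ[μ] 0 := by
  have h1 : ∀ n : ℕ, ((n : ℝ≥0∞) + 1) * modular p μ f ≤ 1 := by
    intro n
    have hn : (0 : ℝ) < n + 1 := by positivity
    have h2 := hf.modular_le_one (r := ((n : ℝ) + 1)⁻¹) (by rw [h]; positivity)
    have h3 := modular_smul_le (p := p) (μ := μ) (θ := ((n : ℝ) + 1)⁻¹) (by positivity)
      (inv_le_one_of_one_le₀ (by simp)) (fun t => f t / ((n : ℝ) + 1)⁻¹)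
    have h4 : (fun t => ((n : ℝ) + 1)⁻¹ * (f t / ((n : ℝ) + 1)⁻¹)) = f := by
      funext t; field_simp
    rw [h4] at h3
    have h5 : ((n : ℝ≥0∞) + 1) = ENNReal.ofReal ((n : ℝ) + 1) := by
      rw [ENNReal.ofReal_add (by positivity) zero_le_one]; simp
    rw [h5]
    calc _ ≤ ENNReal.ofReal ((n : ℝ) + 1) * (ENNReal.ofReal ((n : ℝ) + 1)⁻¹ * 1) := by
          gcongr
          exact h3.trans (by gcongr)
      _ = 1 := by
          rw [mul_one, ← ENNReal.ofReal_mul hn.le, mul_inv_cancel₀ hn.ne', ENNReal.ofReal_one]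
  have h6 : modular p μ f = 0 := by
    by_contra hne
    have hfin : modular p μ f ≠ ∞ := by
      have := h1 0
      simp only [Nat.cast_zero, zero_add, one_mul] at this
      exact ne_top_of_le_ne_top ENNReal.one_ne_top this
    obtain ⟨n, hn⟩ := ENNReal.exists_nat_mul_gt hne ENNReal.one_ne_top
    have := (h1 n).trans_lt hn
    exact absurd this (not_lt.2 (by gcongr; exact le_self_add))
  have hm : AEMeasurable (fun t => ENNReal.ofReal (|f t| ^ p t)) μ :=
    ((hfm.norm).pow p.measurable.aemeasurable).ennreal_ofReal
  have h7 := (lintegral_eq_zero_iff' hm).1 h6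
  filter_upwards [h7] with t ht
  have h8 : |f t| ^ p t ≤ 0 := by simpa using ht
  have h9 := le_antisymm h8 (by positivity)
  rw [Real.rpow_eq_zero (abs_nonneg _) (p.pos t).ne', abs_eq_zero] at h9
  exact h9

end Modular

section Space

variable {Ω : Type*} [MeasurableSpace Ω]

/-- The classes of measurable functions `f` with `ρ_{p(·)}(f / r) < ∞` for some `r > 0`. -/
def vLpSubmodule (p : VarExponent Ω) (μ : Measure Ω) : Submodule ℝ (Ω →ₘ[μ] ℝ) where
  carrier := {f | MemVLp p μ f}
  add_mem' {f g} hf hg :=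
    (MemVLp.add hf hg f.aemeasurable).congr (AEEqFun.coeFn_add f g).symm
  zero_mem' := memVLp_zero.congr AEEqFun.coeFn_zero.symm
  smul_mem' c f hf := (MemVLp.const_mul hf c).congr (AEEqFun.coeFn_smul c f).symm

/-- The variable Lebesgue space `L^{p(·)}(μ)`. -/
def VLp (p : VarExponent Ω) (μ : Measure Ω) : Type _ := ↥(vLpSubmodule p μ)

variable {p q : VarExponent Ω} {μ : Measure Ω}

namespace VLp

instance : AddCommGroup (VLp p μ) := inferInstanceAs (AddCommGroup ↥(vLpSubmodule p μ))

instance : Module ℝ (VLp p μ) := inferInstanceAs (Module ℝ ↥(vLpSubmodule p μ))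

/-- The class of almost everywhere equal functions underlying an element of `L^{p(·)}(μ)`. -/
def toAEEqFun (f : VLp p μ) : Ω →ₘ[μ] ℝ := Subtype.val f

instance : CoeFun (VLp p μ) (fun _ => Ω → ℝ) := ⟨fun f => (f.toAEEqFun : Ω → ℝ)⟩

theorem memVLp (f : VLp p μ) : MemVLp p μ f := Subtype.property f

theorem aemeasurable (f : VLp p μ) : AEMeasurable f μ := f.toAEEqFun.aemeasurable

theorem ext_ae {f g : VLp p μ} (h : (f : Ω → ℝ) =ᵐ[μ] g) : f = g :=
  Subtype.ext (AEEqFun.ext h)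

theorem coeFn_add (f g : VLp p μ) : (↑(f + g) : Ω → ℝ) =ᵐ[μ] fun t => f t + g t :=
  AEEqFun.coeFn_add f.toAEEqFun g.toAEEqFun

theorem coeFn_smul (c : ℝ) (f : VLp p μ) : (↑(c • f) : Ω → ℝ) =ᵐ[μ] fun t => c * f t :=
  AEEqFun.coeFn_smul c f.toAEEqFun

theorem coeFn_zero : (↑(0 : VLp p μ) : Ω → ℝ) =ᵐ[μ] fun _ => 0 :=
  AEEqFun.coeFn_zero (α := Ω) (β := ℝ) (μ := μ)

/-- The norm of `L^{p(·)}(μ)` is the Luxemburg norm. -/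
instance : Norm (VLp p μ) := ⟨fun f => luxNorm p μ f⟩

theorem norm_def (f : VLp p μ) : ‖f‖ = luxNorm p μ f := rfl

theorem normCore : NormedSpace.Core ℝ (VLp p μ) where
  norm_nonneg _ := luxNorm_nonneg
  norm_smul c f := by
    rw [norm_def, luxNorm_congr (coeFn_smul c f), luxNorm_const_mul f.memVLp]
    rfl
  norm_triangle f g := by
    rw [norm_def, luxNorm_congr (coeFn_add f g)]
    exact luxNorm_add_le f.memVLp g.memVLp f.aemeasurable
  norm_eq_zero_iff f := by
    constructor
    · intro h
      exact ext_ae ((ae_eq_zero_of_luxNorm f.memVLp f.aemeasurable h).trans coeFn_zero.symm)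
    · rintro rfl
      have h := luxNorm_const_mul (p := p) (μ := μ) memVLp_zero 0
      rw [norm_def, luxNorm_congr coeFn_zero]
      simpa using h

instance : NormedAddCommGroup (VLp p μ) := NormedAddCommGroup.ofCore normCore

instance : NormedSpace ℝ (VLp p μ) := NormedSpace.ofCore normCore

/-- The element of `L^{p(·)}(μ)` given by a measurable function. -/
def mk (f : Ω → ℝ) (hf : AEStronglyMeasurable f μ) (h : MemVLp p μ f) : VLp p μ :=
  ⟨AEEqFun.mk f hf, h.congr (AEEqFun.coeFn_mk f hf).symm⟩

theorem coeFn_mk (f : Ω → ℝ) (hf : AEStronglyMeasurable f μ) (h : MemVLp p μ f) :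
    (mk f hf h : Ω → ℝ) =ᵐ[μ] f := AEEqFun.coeFn_mk f hf

/-- The product `f χ_A`, as an element of `L^{p(·)}(μ)`. -/
def mulIndicator (f : VLp p μ) (A : Set Ω) (hA : MeasurableSet A) : VLp p μ :=
  mk (A.indicator f) (f.toAEEqFun.aestronglyMeasurable.indicator hA)
    (f.memVLp.mono (.of_forall fun t => by
      by_cases h : t ∈ A <;> simp [h]))

end VLp

theorem VarExponent.ae_le_of_ae_lt (h : ∀ᵐ t ∂μ, q t < p t) : ∀ᵐ t ∂μ, q t ≤ p t :=
  h.mono fun _ ht => ht.le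

theorem modular_le_add_of_le [IsFiniteMeasure μ] (h : ∀ᵐ t ∂μ, q t ≤ p t) (f : Ω → ℝ) :
    modular q μ f ≤ μ univ + modular p μ f := by
  unfold modular
  rw [← lintegral_one, ← lintegral_add_left measurable_const]
  refine lintegral_mono_ae ?_
  filter_upwards [h] with t ht
  rcases le_total |f t| 1 with h1 | h1
  · refine le_trans ?_ le_self_add
    rw [← ENNReal.ofReal_one]
    exact ENNReal.ofReal_le_ofReal (Real.rpow_le_one (abs_nonneg _) h1 (q.pos t).le)
  · refine le_trans ?_ le_add_self
    exact ENNReal.ofReal_le_ofReal (Real.rpow_le_rpow_of_exponent_le h1 ht)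

theorem MemVLp.of_le [IsFiniteMeasure μ] (h : ∀ᵐ t ∂μ, q t ≤ p t) {f : Ω → ℝ}
    (hf : MemVLp p μ f) : MemVLp q μ f := by
  obtain ⟨r, hr, hfr⟩ := hf
  exact ⟨r, hr, (modular_le_add_of_le h _).trans_lt
    (ENNReal.add_lt_top.2 ⟨measure_lt_top μ _, hfr⟩)⟩

theorem luxNorm_le_mul_of_le [IsFiniteMeasure μ] (h : ∀ᵐ t ∂μ, q t ≤ p t) {f : Ω → ℝ}
    (hf : MemVLp p μ f) : luxNorm q μ f ≤ (μ.real univ + 1) * luxNorm p μ f := by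
  set K := μ.real univ + 1 with hK
  have hK1 : 1 ≤ K := by rw [hK]; simp
  have hK0 : 0 < K := one_pos.trans_le hK1
  have key : ∀ r, luxNorm p μ f < r → luxNorm q μ f ≤ K * r := by
    intro r hr
    have hr0 : 0 < r := luxNorm_nonneg.trans_lt hr
    refine luxNorm_le (by positivity) ?_
    have h1 : (fun t => f t / (K * r)) = fun t => K⁻¹ * (f t / r) := by
      funext t; field_simp
    rw [h1]
    refine (modular_smul_le (by positivity) (inv_le_one_of_one_le₀ hK1) _).trans ?_
    have h2 : modular q μ (fun t => f t / r) ≤ ENNReal.ofReal K := by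
      refine (modular_le_add_of_le h _).trans ?_
      rw [hK, ENNReal.ofReal_add (by positivity) zero_le_one, ofReal_measureReal,
        ENNReal.ofReal_one]
      gcongr
      exact hf.modular_le_one hr
    calc _ ≤ ENNReal.ofReal K⁻¹ * ENNReal.ofReal K := by gcongr
      _ = 1 := by
        rw [← ENNReal.ofReal_mul (by positivity), inv_mul_cancel₀ hK0.ne', ENNReal.ofReal_one]
  refine le_of_forall_pos_le_add fun ε hε => ?_
  refine (key (luxNorm p μ f + ε / K) (lt_add_of_pos_right _ (by positivity))).trans ?_
  rw [mul_add]
  gcongr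
  rw [mul_div_cancel₀ _ hK0.ne']

/-- The inclusion `L^{p(·)}(μ) ↪ L^{q(·)}(μ)`, for `q(·) ≤ p(·)` almost everywhere on a finite
measure space: it sends a class of functions to itself. -/
def VLp.inclusion [IsFiniteMeasure μ] (h : ∀ᵐ t ∂μ, q t ≤ p t) : VLp p μ →L[ℝ] VLp q μ :=
  LinearMap.mkContinuous
    { toFun := fun f => ⟨f.toAEEqFun, f.memVLp.of_le h⟩
      map_add' := fun _ _ => rfl
      map_smul' := fun _ _ => rfl }
    (μ.real univ + 1) (fun f => luxNorm_le_mul_of_le h f.memVLp)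

theorem VLp.toAEEqFun_inclusion [IsFiniteMeasure μ] (h : ∀ᵐ t ∂μ, q t ≤ p t) (f : VLp p μ) :
    (VLp.inclusion h f).toAEEqFun = f.toAEEqFun := rfl

theorem memVLp_charFun (p : VarExponent Ω) (μ : Measure Ω) [IsFiniteMeasure μ] (E : Set Ω) :
    MemVLp p μ (E.indicator fun t => 1 / μ.real E ^ (1 / p t)) := by
  refine ⟨1, one_pos, ?_⟩
  have h : modular p μ (fun t => (E.indicator fun t => 1 / μ.real E ^ (1 / p t)) t / 1) ≤
      ∫⁻ _, ENNReal.ofReal (1 / μ.real E) ∂μ := by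
    refine lintegral_mono fun t => ENNReal.ofReal_le_ofReal ?_
    beta_reduce
    by_cases ht : t ∈ E
    · rw [indicator_of_mem ht, div_one, abs_of_nonneg (by positivity),
        Real.div_rpow zero_le_one (by positivity), Real.one_rpow,
        ← Real.rpow_mul (by positivity), one_div_mul_cancel (p.pos t).ne', Real.rpow_one]
    · rw [indicator_of_notMem ht, zero_div, abs_zero, Real.zero_rpow (p.pos t).ne']
      positivity
  refine h.trans_lt ?_
  rw [lintegral_const]
  exact ENNReal.mul_lt_top ENNReal.ofReal_lt_top (measure_lt_top μ _)

/-- The function `χ_E / μ(E)^{1/p(t)}` in `L^{p(·)}(μ)`. -/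
def VLp.charFun (p : VarExponent Ω) (μ : Measure Ω) [IsFiniteMeasure μ] (E : Set Ω)
    (hE : MeasurableSet E) : VLp p μ :=
  VLp.mk (E.indicator fun t => 1 / μ.real E ^ (1 / p t))
    (((measurable_const.div (measurable_const.pow
      (measurable_const.div p.measurable))).indicator hE).aestronglyMeasurable)
    (memVLp_charFun p μ E)

end Space

section Operators

variable {Ω : Type*} [MeasurableSpace Ω]

/-- A sequence in `L^{p(·)}(μ)` is (pairwise) disjoint if any two different members have
almost everywhere disjoint supports. -/
def DisjointSeq {p : VarExponent Ω} {μ : Measure Ω} (f : ℕ → VLp p μ) : Prop :=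
  Pairwise fun m n => ∀ᵐ t ∂μ, f m t = 0 ∨ f n t = 0

/-- The closed linear span `[f_n]` of a sequence. -/
def closedSpan {E : Type*} [NormedAddCommGroup E] [NormedSpace ℝ E] (f : ℕ → E) :
    Submodule ℝ E :=
  (Submodule.span ℝ (range f)).topologicalClosure

/-- The restriction of the (bounded) operator `T` to the subspace `S` is an isomorphism onto its
image, that is, `T` is bounded below on `S`. -/
def IsIsomorphismOn {E F : Type*} [NormedAddCommGroup E] [NormedSpace ℝ E]
    [NormedAddCommGroup F] [NormedSpace ℝ F] (T : E →L[ℝ] F) (S : Submodule ℝ E) : Prop :=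
  ∃ c : ℝ, 0 < c ∧ ∀ x ∈ S, c * ‖x‖ ≤ ‖T x‖

/-- `T` is disjointly strictly singular: its restriction to the closed span of a normalized
disjoint sequence is never an isomorphism. -/
def IsDSS {p : VarExponent Ω} {μ : Measure Ω} {F : Type*} [NormedAddCommGroup F]
    [NormedSpace ℝ F] (T : VLp p μ →L[ℝ] F) : Prop :=
  ∀ f : ℕ → VLp p μ, DisjointSeq f → (∀ n, ‖f n‖ = 1) → ¬ IsIsomorphismOn T (closedSpan f)

/-- `T` is M-weakly compact: `‖T f_n‖ → 0` for every norm bounded disjoint sequence `(f_n)`. -/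
def IsMWeaklyCompact {p : VarExponent Ω} {μ : Measure Ω} {F : Type*} [NormedAddCommGroup F]
    [NormedSpace ℝ F] (T : VLp p μ →L[ℝ] F) : Prop :=
  ∀ f : ℕ → VLp p μ, DisjointSeq f → (∃ C : ℝ, ∀ n, ‖f n‖ ≤ C) →
    Tendsto (fun n => ‖T (f n)‖) atTop (𝓝 0)

/-- `T` is L-weakly compact: the image of the unit ball is equi-integrable, that is,
`sup_{‖f‖ ≤ 1} ‖(T f) χ_{A_n}‖ → 0` whenever `χ_{A_n} → 0` almost everywhere. The supremum is
taken in `[0, ∞]`. -/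
def IsLWeaklyCompact {p q : VarExponent Ω} {μ : Measure Ω} (T : VLp p μ →L[ℝ] VLp q μ) : Prop :=
  ∀ (A : ℕ → Set Ω) (hA : ∀ n, MeasurableSet (A n)),
    (∀ᵐ t ∂μ, Tendsto (fun n => (A n).indicator (fun _ => (1 : ℝ)) t) atTop (𝓝 0)) →
    Tendsto (fun n => ⨆ f ∈ Metric.closedBall (0 : VLp p μ) 1,
      ‖(T f).mulIndicator (A n) (hA n)‖ₑ) atTop (𝓝 0)

/-- The decreasing rearrangement `f^*(x) = inf {s ≥ 0 : μ {t : |f(t)| > s} ≤ x}` of `f`, for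
`x` in `[0, μ(Ω))`. (At the single point `x = 0` the infimum is over the empty set when `f` is
not essentially bounded.) -/
def decRearr {Ω : Type*} [MeasurableSpace Ω] (μ : Measure Ω) (f : Ω → ℝ) (x : ℝ) : ℝ :=
  sInf {s : ℝ | 0 ≤ s ∧ μ {t | s < |f t|} ≤ ENNReal.ofReal x}

end Operators

end

/-! ### Super-exponential tail decay and decreasing rearrangements. -/

section ExponentialTail

/-! Everything is compared with one property of `h = p / (p - q)`: the tail `G(s) = μ {h ≥ s}` is
`O(a ^ (-s))` for every `a > 1` (`HasExpTail`). The integral condition is this property read through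
`h^*`, by a Chebyshev bound in one direction and an integrable `x ^ (-1/2)` majorant in the other.
The limit condition says the same as `G(s) ^ (1/s) → 0`, because `{h ≥ s}` is `{1/h ≤ 1/s}`, so the
values of `(1/h)^*` near `μ(Ω)` record the large values of `h`.

If the tail decays, `a ^ h` is integrable for every `a`. A Young-type inequality bounds `|f / ε| ^
q` by half of `|f| ^ p` plus such a function, uniformly over the unit ball; boundedness of `q` keeps
the base `a` constant. Dominated convergence then gives L-weak compactness. The passage to M-weak
compactness, to DSS and to characteristic functions is soft.

If the tail does not decay, shells `{s_n ≤ h < s_{n+1}}` provide disjoint sets `E_n` with `β ^ h ≤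
μ(E_n)` on `E_n`. Since `1/h = 1 - q/p`, this means `β / μ(E_n) ≤ (μ(E_n) ^ (-1/p)) ^ q`: on each
block the `q`-modular density of the normalized function is at least `β` times its `p`-modular
density. The inclusion is therefore bounded below by `β` on their closed span, which closes the
cycle. -/

theorem setOf_lt_abs_subset {Ω : Type*} (h : Ω → ℝ) (s : ℝ) : {t | s < |h t|} ⊆ {t | s ≤ |h t|} :=
  fun t ht => le_of_lt (show s < |h t| from ht)

theorem setOf_le_abs_subset {Ω : Type*} (h : Ω → ℝ) {s s' : ℝ} (hs : s < s') :
    {t | s' ≤ |h t|} ⊆ {t | s < |h t|} :=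
  fun t ht => lt_of_lt_of_le hs (show s' ≤ |h t| from ht)

variable {Ω : Type*} [MeasurableSpace Ω]

/-- The tails `μ {|h| ≥ s}` decay faster than any exponential. -/
def HasExpTail (μ : Measure Ω) (h : Ω → ℝ) : Prop :=
  ∀ a : ℝ, 1 < a → ∃ C : ℝ, ∀ s : ℝ, 0 ≤ s → μ.real {t | s ≤ |h t|} ≤ C * a ^ (-s)

variable {μ : Measure Ω} {h : Ω → ℝ}

/-- For `s ≤ S` the trivial bound `μ(Ω) ≤ μ(Ω) a ^ S a ^ (-s)` suffices, so small `s` only affect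
the constant. -/
theorem hasExpTail_of_large [IsFiniteMeasure μ]
    (H : ∀ a : ℝ, 1 < a → ∃ C S : ℝ, ∀ s : ℝ, S ≤ s → μ.real {t | s ≤ |h t|} ≤ C * a ^ (-s)) :
    HasExpTail μ h := by
  intro a ha
  obtain ⟨C, S, hS⟩ := H a ha
  have ha0 : 0 < a := one_pos.trans ha
  refine ⟨max C (μ.real univ * a ^ S), fun s _ => ?_⟩
  rcases le_total S s with h1 | h1
  · exact (hS s h1).trans (by gcongr; exact le_max_left _ _)
  · have h2 : 1 ≤ a ^ S * a ^ (-s) := by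
      rw [← Real.rpow_add ha0]
      exact Real.one_le_rpow ha.le (by linarith)
    calc μ.real {t | s ≤ |h t|} ≤ μ.real univ * 1 := by
          rw [mul_one]; exact measureReal_mono (subset_univ _)
      _ ≤ μ.real univ * (a ^ S * a ^ (-s)) := by gcongr
      _ = (μ.real univ * a ^ S) * a ^ (-s) := by ring
      _ ≤ _ := by gcongr; exact le_max_right _ _

theorem tendsto_measureReal_tail [IsFiniteMeasure μ] (hm : Measurable h) :
    Tendsto (fun s : ℝ => μ.real {t | s ≤ |h t|}) atTop (𝓝 0) := by
  have h1 : Tendsto (fun s : ℝ => μ {t | s ≤ |h t|}) atTop (𝓝 (μ (⋂ s : ℝ, {t | s ≤ |h t|}))) := by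
    refine tendsto_measure_iInter_atTop
      (fun s => (measurableSet_le measurable_const hm.abs).nullMeasurableSet) ?_
      ⟨0, measure_ne_top _ _⟩
    intro s s' hs t ht
    exact hs.trans ht
  have h2 : (⋂ s : ℝ, {t | s ≤ |h t|}) = ∅ := by
    refine eq_empty_of_forall_notMem fun t ht => ?_
    have := mem_iInter.1 ht (|h t| + 1)
    simp only [mem_ofPred_eq] at this
    linarith
  rw [h2, measure_empty] at h1
  exact (ENNReal.tendsto_toReal ENNReal.zero_ne_top).comp h1

theorem decRearr_le {x s : ℝ} (hs : 0 ≤ s) (h1 : μ {t | s < |h t|} ≤ ENNReal.ofReal x) :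
    decRearr μ h x ≤ s :=
  csInf_le ⟨0, fun _ h => h.1⟩ ⟨hs, h1⟩

/-- Needed for lower bounds on the rearrangement: the real `sInf ∅` is `0`, which is the wrong value
at `x = 0` for unbounded `h`. -/
theorem exists_decRearr_set [IsFiniteMeasure μ] (hm : Measurable h) {x : ℝ} (hx : 0 < x) :
    {s : ℝ | 0 ≤ s ∧ μ {t | s < |h t|} ≤ ENNReal.ofReal x}.Nonempty := by
  obtain ⟨s, hs, hs0⟩ := (((tendsto_measureReal_tail (μ := μ) hm).eventually_lt_const hx).and
    (eventually_ge_atTop 0)).exists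
  refine ⟨s, hs0, (measure_mono (setOf_lt_abs_subset h s)).trans ?_⟩
  rw [← ofReal_measureReal]
  exact ENNReal.ofReal_le_ofReal hs.le

theorem le_decRearr [IsFiniteMeasure μ] (hm : Measurable h) {x s : ℝ} (hx : 0 < x)
    (h1 : x < μ.real {t | s ≤ |h t|}) : s ≤ decRearr μ h x := by
  refine le_csInf (exists_decRearr_set hm hx) fun σ hσ => ?_
  by_contra! hlt
  have h2 : μ {t | s ≤ |h t|} ≤ ENNReal.ofReal x :=
    (measure_mono (setOf_le_abs_subset h hlt)).trans hσ.2
  exact absurd (ENNReal.toReal_le_of_le_ofReal hx.le h2) (not_le.2 h1)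

/-- Chebyshev for the rearrangement: `h^* ≥ s` on `(0, G(s))`, so `a ^ s G(s)` is at most the
integral, which serves as the constant `C`. -/
theorem hasExpTail_of_lintegral_decRearr [IsFiniteMeasure μ] (hm : Measurable h)
    (H : ∀ a : ℝ, 1 < a →
      ∫⁻ x in Ioo 0 (μ.real univ), ENNReal.ofReal (a ^ decRearr μ h x) < ∞) :
    HasExpTail μ h := by
  intro a ha
  have ha0 : 0 < a := one_pos.trans ha
  refine ⟨(∫⁻ x in Ioo 0 (μ.real univ), ENNReal.ofReal (a ^ decRearr μ h x)).toReal,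
    fun s hs => ?_⟩
  set G := μ.real {t | s ≤ |h t|} with hG
  have hGu : G ≤ μ.real univ := measureReal_mono (subset_univ _)
  have h1 : ENNReal.ofReal (a ^ s) * ENNReal.ofReal G ≤
      ∫⁻ x in Ioo 0 (μ.real univ), ENNReal.ofReal (a ^ decRearr μ h x) := by
    calc ENNReal.ofReal (a ^ s) * ENNReal.ofReal G
        = ∫⁻ x in Ioo 0 G, ENNReal.ofReal (a ^ s) := by simp
      _ ≤ ∫⁻ x in Ioo 0 G, ENNReal.ofReal (a ^ decRearr μ h x) := by
          refine setLIntegral_mono' measurableSet_Ioo fun x hx => ENNReal.ofReal_le_ofReal ?_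
          exact Real.rpow_le_rpow_of_exponent_le ha.le (le_decRearr hm hx.1 hx.2)
      _ ≤ _ := lintegral_mono_set (Ioo_subset_Ioo_right hGu)
  rw [← ENNReal.ofReal_mul (by positivity), ENNReal.ofReal_le_iff_le_toReal (H a ha).ne] at h1
  rw [Real.rpow_neg ha0.le, ← div_eq_mul_inv, le_div_iff₀ (by positivity), mul_comm]
  exact h1

/-- Decay with base `a ^ 2` yields `a ^ h^*(x) ≤ (C / x) ^ (1/2)`, which is integrable at `0`. -/
theorem HasExpTail.lintegral_decRearr_lt_top [IsFiniteMeasure μ] (H : HasExpTail μ h) {a : ℝ} (ha : 1 < a) :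
    ∫⁻ x in Ioo 0 (μ.real univ), ENNReal.ofReal (a ^ decRearr μ h x) < ∞ := by
  have ha0 : 0 < a := one_pos.trans ha
  have hl : 0 < Real.log a := Real.log_pos ha
  obtain ⟨C₀, hC₀⟩ := H (a ^ (2 : ℝ)) (Real.one_lt_rpow ha two_pos)
  set C := max C₀ (μ.real univ) with hC
  have key : ∀ x ∈ Ioo 0 (μ.real univ),
      ENNReal.ofReal (a ^ decRearr μ h x) ≤
        ENNReal.ofReal (C ^ (1 / 2 : ℝ) * x ^ (-(1 / 2) : ℝ)) := by
    intro x hx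
    refine ENNReal.ofReal_le_ofReal ?_
    have hCx : x ≤ C := hx.2.le.trans (le_max_right _ _)
    have hC0 : 0 < C := hx.1.trans_le hCx
    have hq : 1 ≤ C / x := (one_le_div hx.1).2 hCx
    -- This `s` solves `a ^ (2 s) = C / x`, so the tail bound at `s` is at most `x`. Taking `C ≥
    -- μ(Ω)` makes `s` nonnegative.
    set s := Real.log (C / x) / (2 * Real.log a) with hs
    have hs0 : 0 ≤ s := div_nonneg (Real.log_nonneg hq) (by positivity)
    have has : a ^ s = (C / x) ^ (1 / 2 : ℝ) := by
      rw [Real.rpow_def_of_pos ha0, Real.rpow_def_of_pos (by linarith), hs]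
      congr 1
      field_simp
    have hle : decRearr μ h x ≤ s := by
      refine decRearr_le hs0 ((measure_mono (setOf_lt_abs_subset h s)).trans ?_)
      rw [← ofReal_measureReal]
      refine ENNReal.ofReal_le_ofReal ((hC₀ s hs0).trans ?_)
      have h2 : (a ^ (2 : ℝ)) ^ (-s) = x / C := by
        rw [← Real.rpow_mul ha0.le, show (2 : ℝ) * -s = s * (-2) by ring, Real.rpow_mul ha0.le,
          has, ← Real.rpow_mul (by positivity)]
        norm_num
        rw [Real.rpow_neg_one, inv_div]
      rw [h2, mul_div_assoc', div_le_iff₀ hC0, mul_comm]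
      exact mul_le_mul_of_nonneg_left (le_max_left _ _) hx.1.le
    calc a ^ decRearr μ h x ≤ a ^ s := Real.rpow_le_rpow_of_exponent_le ha.le hle
      _ = C ^ (1 / 2 : ℝ) * x ^ (-(1 / 2) : ℝ) := by
        rw [has, Real.div_rpow hC0.le hx.1.le, Real.rpow_neg hx.1.le, div_eq_mul_inv]
  refine (setLIntegral_mono' measurableSet_Ioo key).trans_lt ?_
  have hint : IntegrableOn (fun x : ℝ => C ^ (1 / 2 : ℝ) * x ^ (-(1 / 2) : ℝ))
      (Ioo 0 (μ.real univ)) :=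
    by
    refine Integrable.const_mul ?_ _
    rcases (measureReal_nonneg (μ := μ) (s := univ)).eq_or_lt with h0 | h0
    · simp [← h0]
    · exact (intervalIntegral.integrableOn_Ioo_rpow_iff h0).2 (by norm_num)
  exact hint.lintegral_lt_top

/-- Slice at the integer part of `|h|`; decay with base `2 * a` turns the sum into a geometric
series of ratio `1/2`. -/
theorem HasExpTail.lintegral_rpow_lt_top [IsFiniteMeasure μ] (hm : Measurable h) (H : HasExpTail μ h) {a : ℝ} (ha : 1 < a) :
    ∫⁻ t, ENNReal.ofReal (a ^ |h t|) ∂μ < ∞ := by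
  have ha0 : 0 < a := one_pos.trans ha
  obtain ⟨C, hC⟩ := H (2 * a) (by linarith)
  have h1 : ∀ t, ENNReal.ofReal (a ^ |h t|) ≤
      ∑' n : ℕ, {t | (n : ℝ) ≤ |h t|}.indicator
        (fun _ => ENNReal.ofReal (a ^ ((n : ℝ) + 1))) t := by
    intro t
    refine le_trans ?_ (ENNReal.le_tsum ⌊|h t|⌋₊)
    have hmem : t ∈ {t | ((⌊|h t|⌋₊ : ℕ) : ℝ) ≤ |h t|} := Nat.floor_le (abs_nonneg (h t))
    have hmem' : t ∈ {t' | ((⌊|h t|⌋₊ : ℕ) : ℝ) ≤ |h t'|} := hmem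
    rw [indicator_of_mem hmem']
    exact ENNReal.ofReal_le_ofReal
      (Real.rpow_le_rpow_of_exponent_le ha.le (Nat.lt_floor_add_one _).le)
  have hms : ∀ n : ℕ, MeasurableSet {t | (n : ℝ) ≤ |h t|} :=
    fun n => measurableSet_le measurable_const hm.abs
  calc ∫⁻ t, ENNReal.ofReal (a ^ |h t|) ∂μ
      ≤ ∫⁻ t, ∑' n : ℕ, {t | (n : ℝ) ≤ |h t|}.indicator
        (fun _ => ENNReal.ofReal (a ^ ((n : ℝ) + 1))) t ∂μ := lintegral_mono h1
    _ = ∑' n : ℕ, ENNReal.ofReal (a ^ ((n : ℝ) + 1)) * μ {t | (n : ℝ) ≤ |h t|} := by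
        rw [lintegral_tsum fun n => (measurable_const.indicator (hms n)).aemeasurable]
        simp only [lintegral_indicator_const (hms _)]
    _ ≤ ∑' n : ℕ, ENNReal.ofReal (C * a * (1 / 2) ^ n) := by
        refine ENNReal.tsum_le_tsum fun n => ?_
        rw [← ofReal_measureReal, ← ENNReal.ofReal_mul (by positivity)]
        refine ENNReal.ofReal_le_ofReal ((mul_le_mul_of_nonneg_left (hC n n.cast_nonneg)
          (by positivity)).trans_eq ?_)
        rw [Real.rpow_neg (by positivity), Real.rpow_natCast, Real.rpow_add_one ha0.ne',
          Real.rpow_natCast, mul_pow, one_div, inv_pow]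
        field_simp
    _ < ∞ := (((summable_geometric_two).mul_left (C * a)).tsum_ofReal_lt_top)

/-- Write `M - x = ε ^ s`. If the power exceeded `ε`, then `(1/h)^*(x) < 1/s`, so `{h ≥ s}` would
have measure at least `ε ^ s`, too much for the tail when `s` is large. -/
theorem HasExpTail.tendsto_rpow_decRearr_inv [IsFiniteMeasure μ] (hm : Measurable h)
    (h1 : ∀ᵐ t ∂μ, 1 ≤ |h t|) (H : HasExpTail μ h) :
    Tendsto (fun x : ℝ => (μ.real univ - x) ^ decRearr μ (fun t => (h t)⁻¹) x)
        (𝓝[Ico 0 (μ.real univ)] μ.real univ) (𝓝 0) := by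
  set M := μ.real univ with hM
  have key : ∀ ε : ℝ, 0 < ε → ε < 1 → ∃ δ : ℝ, 0 < δ ∧ ∀ x ∈ Ico 0 M, M - x < δ →
      (M - x) ^ decRearr μ (fun t => (h t)⁻¹) x ≤ ε := by
    intro ε hε hε1
    -- With this base, `ε ^ s ≤ C (2 / ε) ^ (-s)` reduces to `2 ^ s ≤ C`. The choice `δ = ε ^ N`
    -- below forces `s > N`, where `2 ^ N > C`.
    obtain ⟨C, hC⟩ := H (2 / ε) ((one_lt_div hε).2 (by linarith))
    obtain ⟨N, hN⟩ := pow_unbounded_of_one_lt C one_lt_two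
    refine ⟨ε ^ (N : ℝ), by positivity, fun x hx hxδ => ?_⟩
    have hy0 : 0 < M - x := sub_pos.2 hx.2
    have hy1 : M - x < 1 := hxδ.trans_le (Real.rpow_le_one hε.le hε1.le N.cast_nonneg)
    set s := Real.log (M - x) / Real.log ε with hs
    have hlε : Real.log ε < 0 := Real.log_neg hε hε1
    have hs0 : 0 < s := div_pos_of_neg_of_neg (Real.log_neg hy0 hy1) hlε
    have hys : M - x = ε ^ s := by
      rw [Real.rpow_def_of_pos hε, hs, mul_div_cancel₀ _ hlε.ne, Real.exp_log hy0]
    have hNs : (N : ℝ) < s := by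
      rw [hys] at hxδ
      exact (Real.rpow_lt_rpow_left_iff_of_base_lt_one hε hε1).1 hxδ
    by_contra! hlt
    have hσ : decRearr μ (fun t => (h t)⁻¹) x < 1 / s := by
      rw [hys, ← Real.rpow_mul hε.le] at hlt
      have h2 : s * decRearr μ (fun t => (h t)⁻¹) x < 1 := by
        exact (Real.rpow_lt_rpow_left_iff_of_base_lt_one hε hε1).1 (by rwa [Real.rpow_one])
      rwa [lt_div_iff₀ hs0, mul_comm]
    -- The bound `|1/h| ≤ 1` puts `1` in this set even when `x = 0`.
    have hne : {σ : ℝ | 0 ≤ σ ∧ μ {t | σ < |(h t)⁻¹|} ≤ ENNReal.ofReal x}.Nonempty := by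
      refine ⟨1, zero_le_one, ?_⟩
      have h3 : μ {t | 1 < |(h t)⁻¹|} = 0 := by
        refine measure_eq_zero_iff_ae_notMem.2 ?_
        filter_upwards [h1] with t ht
        simp only [not_lt, abs_inv]
        exact inv_le_one_of_one_le₀ ht
      rw [h3]; exact zero_le
    obtain ⟨σ, ⟨hσ0, hσμ⟩, hσs⟩ := exists_lt_of_csInf_lt hne hσ
    have hsub : {t | σ < |(h t)⁻¹|}ᶜ ≤ᵐ[μ] {t | s ≤ |h t|} := by
      filter_upwards [h1] with t ht hts
      have h4 : ¬ σ < |(h t)⁻¹| := hts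
      rw [abs_inv, not_lt] at h4
      have h5 : |h t|⁻¹ ≤ s⁻¹ := by rw [← one_div s]; exact h4.trans hσs.le
      exact (inv_le_inv₀ (by linarith) hs0).1 h5
    have hms : MeasurableSet {t | σ < |(h t)⁻¹|} := measurableSet_lt measurable_const hm.inv.abs
    have h6 : M - x ≤ μ.real {t | s ≤ |h t|} := by
      have h7 : μ.real {t | σ < |(h t)⁻¹|}ᶜ ≤ μ.real {t | s ≤ |h t|} :=
        ENNReal.toReal_mono (measure_ne_top _ _) (measure_mono_ae hsub)
      rw [measureReal_compl hms] at h7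
      have h8 : μ.real {t | σ < |(h t)⁻¹|} ≤ x := ENNReal.toReal_le_of_le_ofReal hx.1 hσμ
      linarith
    have h9 : ε ^ s ≤ C * (2 / ε) ^ (-s) := by
      rw [← hys]; exact h6.trans (hC s hs0.le)
    rw [Real.rpow_neg (by positivity), ← div_eq_mul_inv, le_div_iff₀ (by positivity),
      ← Real.mul_rpow hε.le (by positivity), mul_div_cancel₀ _ hε.ne'] at h9
    have h10 : (2 : ℝ) ^ (N : ℝ) ≤ 2 ^ s := Real.rpow_le_rpow_of_exponent_le one_le_two hNs.le
    rw [Real.rpow_natCast] at h10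
    linarith
  rw [Metric.tendsto_nhds]
  intro ε hε
  obtain ⟨δ, hδ, hδx⟩ := key (min (ε / 2) (1 / 2)) (by positivity) (by
    exact (min_le_right _ _).trans_lt (by norm_num))
  filter_upwards [self_mem_nhdsWithin,
    mem_nhdsWithin_of_mem_nhds (Ioi_mem_nhds (show M - δ < M by linarith))] with x hx hx'
  have h2 := (hδx x hx (by have : M - δ < x := hx'; linarith)).trans (min_le_left _ _)
  have h3 : 0 ≤ (M - x) ^ decRearr μ (fun t => (h t)⁻¹) x :=
    Real.rpow_nonneg (sub_nonneg.2 hx.2.le) _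
  rw [dist_zero_right, Real.norm_of_nonneg h3]
  linarith

/-- Evaluate the limit at `x = M - G(s)`: there `(1/h)^*(x) ≤ 1/s`, hence `G(s) ^ (1/s) < 1/a` for
large `s`. -/
theorem hasExpTail_of_tendsto_rpow_decRearr_inv [IsFiniteMeasure μ] (hm : Measurable h)
    (H : Tendsto (fun x : ℝ => (μ.real univ - x) ^ decRearr μ (fun t => (h t)⁻¹) x)
        (𝓝[Ico 0 (μ.real univ)] μ.real univ) (𝓝 0)) :
    HasExpTail μ h := by
  refine hasExpTail_of_large fun a ha => ?_
  have ha0 : 0 < a := one_pos.trans ha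
  set M := μ.real univ with hM
  have h1 := H.eventually_lt_const (inv_pos.2 ha0)
  rw [eventually_nhdsWithin_iff, Metric.eventually_nhds_iff] at h1
  obtain ⟨δ, hδ, hδx⟩ := h1
  -- `G < δ` makes the limit applicable; `G < 1` makes `G ^ ·` decreasing in the exponent.
  obtain ⟨S, hS⟩ := eventually_atTop.1
    (((tendsto_measureReal_tail (μ := μ) hm).eventually_lt_const (lt_min hδ one_pos)).and
      (eventually_gt_atTop 0))
  refine ⟨1, S, fun s hs => ?_⟩
  obtain ⟨hGδ, hs0⟩ := hS s hs
  set G := μ.real {t | s ≤ |h t|} with hG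
  rw [one_mul]
  have hG0 : 0 ≤ G := measureReal_nonneg
  rcases hG0.eq_or_lt with h0 | h0
  -- `G = 0` is separate because it would place `x` at the excluded endpoint `M`.
  · rw [← h0]; positivity
  have hGM : G ≤ M := measureReal_mono (subset_univ _)
  have h2 : dist (M - G) M < δ := by
    rw [Real.dist_eq, show M - G - M = -G by ring, abs_neg, abs_of_nonneg hG0]
    exact hGδ.trans_le (min_le_left _ _)
  have h3 := hδx h2 ⟨by linarith, by linarith⟩
  rw [sub_sub_cancel] at h3
  have hms : MeasurableSet {t | s ≤ |h t|} := measurableSet_le measurable_const hm.abs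
  have h4 : decRearr μ (fun t => (h t)⁻¹) (M - G) ≤ s⁻¹ := by
    refine decRearr_le (by positivity) ?_
    have hsub : {t | s⁻¹ < |(h t)⁻¹|} ⊆ {t | s ≤ |h t|}ᶜ := by
      intro t ht ht'
      have h5 : s⁻¹ < |(h t)⁻¹| := ht
      have h6 : s ≤ |h t| := ht'
      rw [abs_inv] at h5
      exact absurd h5 (not_lt.2 (inv_anti₀ hs0 h6))
    refine (measure_mono hsub).trans ?_
    rw [← ofReal_measureReal, measureReal_compl hms]
  have h5 : G ^ s⁻¹ < a⁻¹ :=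
    (Real.rpow_le_rpow_of_exponent_ge h0 (hGδ.le.trans (min_le_right _ _)) h4).trans_lt h3
  calc G = (G ^ s⁻¹) ^ s := by rw [← Real.rpow_mul hG0, inv_mul_cancel₀ hs0.ne', Real.rpow_one]
    _ ≤ (a⁻¹) ^ s := Real.rpow_le_rpow (by positivity) h5.le hs0.le
    _ = a ^ (-s) := by rw [Real.inv_rpow ha0.le, Real.rpow_neg ha0.le]

end ExponentialTail

/-! ### From tail decay to weak compactness and strict singularity. -/

section Inclusion

variable {Ω : Type*} [MeasurableSpace Ω] {μ : Measure Ω} {p q : VarExponent Ω}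

/-- By convexity, a norm below `r < β ≤ 1` would give `ρ(f) ≤ r ρ(f / r) ≤ r < β`. -/
theorem le_luxNorm {f : Ω → ℝ} (hf : MemVLp p μ f) {β : ℝ} (h1 : β ≤ 1)
    (h : ENNReal.ofReal β ≤ modular p μ f) : β ≤ luxNorm p μ f := by
  by_contra! hlt
  obtain ⟨r, hr, hrβ⟩ := exists_between hlt
  have hr0 : 0 < r := luxNorm_nonneg.trans_lt hr
  have h2 := modular_smul_le (p := p) (μ := μ) hr0.le (hrβ.le.trans h1) (fun t => f t / r)
  have h3 : (fun t => r * (f t / r)) = f := by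
    funext t; field_simp
  rw [h3] at h2
  have h4 : modular p μ f ≤ ENNReal.ofReal r := by
    refine h2.trans ?_
    calc _ ≤ ENNReal.ofReal r * 1 := by gcongr; exact hf.modular_le_one hr
      _ = _ := mul_one _
  exact absurd (h.trans h4) (not_le.2 ((ENNReal.ofReal_lt_ofReal_iff (hr0.trans hrβ)).2 hrβ))

theorem VLp.luxNorm_mk (f : Ω → ℝ) (hf : AEStronglyMeasurable f μ) (h : MemVLp p μ f) :
    ‖VLp.mk f hf h‖ = luxNorm p μ f :=
  luxNorm_congr (VLp.coeFn_mk f hf h)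

/-- A Young-type inequality: either the first term on the right already dominates, or `u ^ (x - y) ≤
2 b`, and then `u` is eliminated in favour of `b`. -/
theorem rpow_mul_le_half_rpow_add {u b x y : ℝ} (hu : 0 ≤ u) (hb : 0 ≤ b) (hy : 0 < y)
    (hxy : y < x) : u ^ y * b ≤ 1 / 2 * u ^ x + (2 * b) ^ (x / (x - y)) := by
  have hd : 0 < x - y := sub_pos.2 hxy
  have h2 : 0 ≤ (2 * b) ^ (x / (x - y)) := by positivity
  rcases hu.eq_or_lt with rfl | hu0
  · rw [Real.zero_rpow hy.ne', zero_mul]; positivity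
  rcases le_or_gt (u ^ y * b) (1 / 2 * u ^ x) with h1 | h1
  · linarith
  have hux : u ^ x = u ^ y * u ^ (x - y) := by rw [← Real.rpow_add hu0]; ring_nf
  have h3 : u ^ (x - y) ≤ 2 * b := by
    rw [hux] at h1
    have : 0 < u ^ y := by positivity
    nlinarith
  have hbpos : 0 < 2 * b := lt_of_lt_of_le (by positivity) h3
  have h4 : u ^ y ≤ (2 * b) ^ (y / (x - y)) := by
    calc u ^ y = (u ^ (x - y)) ^ (y / (x - y)) := by
          rw [← Real.rpow_mul hu, mul_div_cancel₀ _ hd.ne']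
      _ ≤ _ := Real.rpow_le_rpow (by positivity) h3 (by positivity)
  have h5 : (2 * b) ^ (x / (x - y)) = (2 * b) ^ (y / (x - y)) * (2 * b) := by
    rw [← Real.rpow_add_one hbpos.ne']
    congr 1
    field_simp
    ring
  have h6 : 0 ≤ u ^ x := by positivity
  have h7 : u ^ y * b ≤ (2 * b) ^ (y / (x - y)) * (2 * b) := by
    refine mul_le_mul h4 (by linarith) hb (by positivity)
  linarith

/-- The exponent `p / (p - q)`, conjugate to `p / q`. -/
noncomputable def gapExponent (p q : VarExponent Ω) (t : Ω) : ℝ := p t / (p t - q t)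

theorem measurable_gapExponent : Measurable (gapExponent p q) :=
  p.measurable.div (p.measurable.sub q.measurable)

theorem one_le_gapExponent {t : Ω} (h : q t < p t) : 1 ≤ gapExponent p q t := by
  rw [gapExponent, one_le_div (sub_pos.2 h)]
  linarith [q.pos t]

/-- The Young-type inequality with `b = ε ^ (-q)` splits the `q`-modular into at most `1/2` from `f`
and an integral of `a ^ h` over `A n` that does not depend on `f`. -/
theorem HasExpTail.isLWeaklyCompact_inclusion [IsFiniteMeasure μ] (hqp : ∀ᵐ t ∂μ, q t < p t)
    (hq : q.plus μ < ∞) (H : HasExpTail μ (gapExponent p q)) :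
    IsLWeaklyCompact (VLp.inclusion (VarExponent.ae_le_of_ae_lt hqp)) := by
  intro A hA hAlim
  obtain ⟨Q, hQ⟩ : ∃ Q : ℝ, ∀ᵐ t ∂μ, q t ≤ Q := by
    refine ⟨(q.plus μ).toReal, ?_⟩
    filter_upwards [ENNReal.ae_le_essSup (μ := μ) (fun t => ENNReal.ofReal (q t))] with t ht
    exact (ENNReal.ofReal_le_iff_le_toReal hq.ne).1 ht
  have key : ∀ ε : ℝ, 0 < ε → ε < 1 → ∀ᶠ n in atTop, ∀ f : VLp p μ, ‖f‖ ≤ 1 →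
      luxNorm q μ ((A n).indicator f) ≤ 2 * ε := by
    intro ε hε hε1
    -- A constant base dominating `2 * ε ^ (-q t)`, since `q ≤ Q` and `ε < 1`; the `2` guarantees `a
    -- > 1`.
    set a := max 2 (2 * ε ^ (-Q)) with ha
    have ha1 : 1 < a := one_lt_two.trans_le (le_max_left _ _)
    have hlim : Tendsto
        (fun n => ∫⁻ t, (A n).indicator (fun t => ENNReal.ofReal (a ^ |gapExponent p q t|)) t ∂μ)
        atTop (𝓝 (∫⁻ _, 0 ∂μ)) := by
      have hmeas : Measurable fun t => ENNReal.ofReal (a ^ |gapExponent p q t|) :=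
        (measurable_const.pow measurable_gapExponent.abs).ennreal_ofReal
      refine tendsto_lintegral_of_dominated_convergence
        (fun t => ENNReal.ofReal (a ^ |gapExponent p q t|))
        (fun n => hmeas.indicator (hA n))
        (fun n => .of_forall fun t => indicator_le_self _ _ _)
        (H.lintegral_rpow_lt_top measurable_gapExponent ha1).ne ?_
      filter_upwards [hAlim] with t ht
      refine tendsto_const_nhds.congr' ?_
      filter_upwards [ht.eventually_lt_const one_pos] with n hn
      by_cases hmem : t ∈ A n
      · simp [hmem] at hn
      · simp [hmem]
    rw [lintegral_zero] at hlim
    have h2 : (0 : ℝ≥0∞) < 2⁻¹ := by simp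
    filter_upwards [hlim.eventually_lt_const h2] with n hn f hf
    -- Dividing by `2` leaves strict room above the norm; this is the `2` in the bound `2 * ε`.
    have hf1 : modular p μ (fun t => f t / 2) ≤ 1 :=
      f.memVLp.modular_le_one (lt_of_le_of_lt hf one_lt_two)
    refine luxNorm_le (by positivity) ?_
    calc modular q μ (fun t => (A n).indicator f t / (2 * ε))
        ≤ ∫⁻ t, ((A n).indicator (fun t => ENNReal.ofReal (a ^ |gapExponent p q t|)) t +
            ENNReal.ofReal (1 / 2) * ENNReal.ofReal (|f t / 2| ^ p t)) ∂μ := by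
          refine lintegral_mono_ae ?_
          filter_upwards [hqp, hQ] with t ht hQt
          by_cases hmem : t ∈ A n
          · rw [indicator_of_mem hmem, indicator_of_mem hmem,
              ← ENNReal.ofReal_mul (by norm_num), ← ENNReal.ofReal_add (by positivity)
                (by positivity)]
            refine ENNReal.ofReal_le_ofReal ?_
            have h3 : |f t / (2 * ε)| ^ q t = |f t / 2| ^ q t * ε ^ (-q t) := by
              rw [← div_div, abs_div _ ε, abs_of_pos hε, Real.div_rpow (abs_nonneg _) hε.le,
                Real.rpow_neg hε.le, div_eq_mul_inv]
            have h4 := rpow_mul_le_half_rpow_add (abs_nonneg (f t / 2))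
              (show 0 ≤ ε ^ (-q t) by positivity) (q.pos t) ht
            have h5 : 2 * ε ^ (-q t) ≤ a := by
              refine le_trans ?_ (le_max_right _ _)
              gcongr 2 * ?_
              exact Real.rpow_le_rpow_of_exponent_ge hε hε1.le (by linarith)
            have h6 : (2 * ε ^ (-q t)) ^ (p t / (p t - q t)) ≤ a ^ |gapExponent p q t| := by
              rw [abs_of_pos (one_pos.trans_le (one_le_gapExponent ht))]
              exact Real.rpow_le_rpow (by positivity) h5
                (one_pos.trans_le (one_le_gapExponent ht)).le
            rw [h3]
            linarith
          · rw [indicator_of_notMem hmem, zero_div, abs_zero, Real.zero_rpow (q.pos t).ne']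
            simp
      _ = _ := lintegral_add_left (((measurable_const.pow
          measurable_gapExponent.abs).ennreal_ofReal).indicator (hA n)) _
      _ ≤ 2⁻¹ + ENNReal.ofReal (1 / 2) * 1 := by
          rw [lintegral_const_mul' _ _ ENNReal.ofReal_ne_top]
          gcongr
          exact hf1
      _ = 1 := by
          rw [mul_one, one_div, ENNReal.ofReal_inv_of_pos two_pos]
          simp [ENNReal.inv_two_add_inv_two]
  rw [ENNReal.tendsto_nhds_zero]
  intro ε hε
  obtain ⟨δ, hδ, hδ1, hδε⟩ : ∃ δ : ℝ, 0 < δ ∧ δ < 1 ∧ ENNReal.ofReal (2 * δ) ≤ ε := by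
    obtain ⟨r, hr, hrε⟩ := ENNReal.lt_iff_exists_nnreal_btwn.1 hε
    have hr0 : 0 < (r : ℝ) := by exact_mod_cast hr
    refine ⟨min (r / 2) (1 / 2), by positivity, (min_le_right _ _).trans_lt (by norm_num), ?_⟩
    refine le_trans ?_ hrε.le
    rw [← ENNReal.ofReal_coe_nnreal]
    refine ENNReal.ofReal_le_ofReal ?_
    linarith [min_le_left ((r : ℝ) / 2) (1 / 2)]
  filter_upwards [key δ hδ hδ1] with n hn
  refine iSup₂_le fun f hf => le_trans ?_ hδε
  rw [← ofReal_norm]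
  refine ENNReal.ofReal_le_ofReal ?_
  rw [VLp.mulIndicator, VLp.luxNorm_mk, VLp.toAEEqFun_inclusion]
  exact hn f (by simpa using hf)

/-- Almost every point lies in at most one support, so the indicators of the supports tend to `0`,
and cutting `f n` to its own support changes nothing. -/
theorem IsLWeaklyCompact.isMWeaklyCompact {T : VLp p μ →L[ℝ] VLp q μ}
    (hT : ∀ f, (T f).toAEEqFun = f.toAEEqFun) (H : IsLWeaklyCompact T) : IsMWeaklyCompact T := by
  intro f hf ⟨C, hC⟩
  set A : ℕ → Set Ω := fun n => {t | f n t ≠ 0} with hAdef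
  have hA : ∀ n, MeasurableSet (A n) := fun n =>
    ((f n).toAEEqFun.measurable (measurableSet_singleton 0)).compl
  have hlim : ∀ᵐ t ∂μ, Tendsto (fun n => (A n).indicator (fun _ => (1 : ℝ)) t) atTop (𝓝 0) := by
    have h1 : ∀ᵐ t ∂μ, ∀ m n, m ≠ n → f m t = 0 ∨ f n t = 0 := by
      rw [ae_all_iff]; intro m
      rw [ae_all_iff]; intro n
      by_cases hmn : m = n
      · exact .of_forall fun t h => absurd hmn h
      · filter_upwards [hf hmn] with t ht _ using ht
    filter_upwards [h1] with t ht
    refine tendsto_const_nhds.congr' ?_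
    by_cases hex : ∃ m, f m t ≠ 0
    · obtain ⟨m, hm⟩ := hex
      filter_upwards [eventually_gt_atTop m] with n hn
      have h2 : t ∉ A n := not_not.2 ((ht m n hn.ne).resolve_left hm)
      rw [indicator_of_notMem h2]
    · push Not at hex
      refine .of_forall fun n => ?_
      have h2 : t ∉ A n := not_not.2 (hex n)
      exact (indicator_of_notMem h2 _).symm
  have h3 := H A hA hlim
  set K := max C 1 with hK
  have hK0 : 0 < K := one_pos.trans_le (le_max_right _ _)
  have h4 : ∀ n, ‖T (f n)‖ₑ ≤ ENNReal.ofReal K *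
      ⨆ g ∈ Metric.closedBall (0 : VLp p μ) 1, ‖(T g).mulIndicator (A n) (hA n)‖ₑ := by
    intro n
    have h5 : K⁻¹ • f n ∈ Metric.closedBall (0 : VLp p μ) 1 := by
      rw [mem_closedBall_zero_iff, norm_smul, Real.norm_of_nonneg (by positivity),
        inv_mul_le_one₀ hK0]
      exact (hC n).trans (le_max_left _ _)
    have h6 : (T (K⁻¹ • f n)).mulIndicator (A n) (hA n) = T (K⁻¹ • f n) := by
      refine VLp.ext_ae ((VLp.coeFn_mk _ _ _).trans ?_)
      rw [hT]
      filter_upwards [VLp.coeFn_smul K⁻¹ (f n)] with t ht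
      by_cases hmem : t ∈ A n
      · rw [indicator_of_mem hmem]
      · rw [indicator_of_notMem hmem, ht, not_not.1 hmem, mul_zero]
    have h7 : ‖T (f n)‖ₑ = ENNReal.ofReal K * ‖T (K⁻¹ • f n)‖ₑ := by
      rw [map_smul, ← ofReal_norm, ← ofReal_norm, ← ENNReal.ofReal_mul hK0.le, norm_smul,
        Real.norm_of_nonneg (by positivity), mul_inv_cancel_left₀ hK0.ne']
    rw [h7]
    gcongr
    calc _ = ‖(T (K⁻¹ • f n)).mulIndicator (A n) (hA n)‖ₑ := by rw [h6]
      _ ≤ _ := le_iSup₂ (f := fun (g : VLp p μ) (_ : g ∈ Metric.closedBall (0 : VLp p μ) 1) =>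
        ‖(T g).mulIndicator (A n) (hA n)‖ₑ) _ h5
  have h8 : Tendsto (fun n => ‖T (f n)‖ₑ) atTop (𝓝 0) := by
    refine tendsto_of_tendsto_of_tendsto_of_le_of_le tendsto_const_nhds ?_ (fun _ => zero_le) h4
    simpa using ENNReal.Tendsto.const_mul h3 (Or.inr ENNReal.ofReal_ne_top)
  have h9 := (ENNReal.tendsto_toReal ENNReal.zero_ne_top).comp h8
  simpa [Function.comp_def] using h9

theorem IsMWeaklyCompact.isDSS {F : Type*} [NormedAddCommGroup F] [NormedSpace ℝ F]
    {T : VLp p μ →L[ℝ] F} (H : IsMWeaklyCompact T) : IsDSS T := by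
  rintro f hf hf1 ⟨c, hc, hcT⟩
  obtain ⟨n, hn⟩ := ((H f hf ⟨1, fun n => (hf1 n).le⟩).eventually_lt_const hc).exists
  have := hcT (f n) (Submodule.le_topologicalClosure _ (Submodule.subset_span (mem_range_self n)))
  rw [hf1 n, mul_one] at this
  linarith

theorem abs_charFun_rpow {E : Set Ω} {t : Ω} (ht : t ∈ E) (hE : 0 < μ.real E) :
    |E.indicator (fun t => 1 / μ.real E ^ (1 / p t)) t| ^ p t = (μ.real E)⁻¹ := by
  rw [indicator_of_mem ht, abs_of_nonneg (by positivity),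
    Real.div_rpow zero_le_one (by positivity), Real.one_rpow,
    ← Real.rpow_mul (by positivity), one_div_mul_cancel (p.pos t).ne', Real.rpow_one, one_div]

theorem VLp.norm_charFun [IsFiniteMeasure μ] {E : Set Ω} (hE : MeasurableSet E) (hE0 : 0 < μ E) :
    ‖VLp.charFun p μ E hE‖ = 1 := by
  have hE' : 0 < μ.real E := ENNReal.toReal_pos hE0.ne' (measure_ne_top _ _)
  have h1 : modular p μ (E.indicator fun t => 1 / μ.real E ^ (1 / p t)) = 1 := by
    have : ∀ t, ENNReal.ofReal (|E.indicator (fun t => 1 / μ.real E ^ (1 / p t)) t| ^ p t) =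
        E.indicator (fun _ => ENNReal.ofReal (μ.real E)⁻¹) t := by
      intro t
      by_cases ht : t ∈ E
      · rw [abs_charFun_rpow ht hE', indicator_of_mem ht]
      · rw [indicator_of_notMem ht, indicator_of_notMem ht, abs_zero,
          Real.zero_rpow (p.pos t).ne', ENNReal.ofReal_zero]
    rw [modular, lintegral_congr this, lintegral_indicator_const hE, ← ofReal_measureReal,
      ← ENNReal.ofReal_mul (by positivity), inv_mul_cancel₀ hE'.ne', ENNReal.ofReal_one]
  rw [VLp.charFun, VLp.luxNorm_mk]
  refine le_antisymm (luxNorm_le one_pos (by simpa using h1.le)) ?_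
  exact le_luxNorm (memVLp_charFun p μ E) le_rfl (by rw [h1, ENNReal.ofReal_one])

theorem disjointSeq_charFun [IsFiniteMeasure μ] {E : ℕ → Set Ω} (hE : ∀ n, MeasurableSet (E n))
    (hd : Pairwise fun m n => Disjoint (E m) (E n)) :
    DisjointSeq fun n => VLp.charFun p μ (E n) (hE n) := by
  intro m n hmn
  filter_upwards [VLp.coeFn_mk _ _ (memVLp_charFun p μ (E m)),
    VLp.coeFn_mk _ _ (memVLp_charFun p μ (E n))] with t h1 h2
  by_cases ht : t ∈ E m
  · right
    exact h2.trans (indicator_of_notMem (disjoint_left.1 (hd hmn) ht) _)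
  · left
    exact h1.trans (indicator_of_notMem ht _)

end Inclusion

/-! ### Slow tails and the lower estimate on block spans. -/

section LowerEstimate

variable {Ω : Type*} [MeasurableSpace Ω] {μ : Measure Ω} [IsFiniteMeasure μ]

/-- Failure gives some `a` and arbitrarily large `s` with `G(s) > a ^ (-s)`. Choosing such `s_n`
with `G` at least halving, each shell keeps measure `a ^ (-s_n) / 2 ≥ (2a) ^ (-s_n)`, so `β =
1/(2a)` works. -/
theorem exists_disjoint_sets_of_not_hasExpTail {h : Ω → ℝ} (hm : Measurable h)
    (H : ¬ HasExpTail μ h) :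
    ∃ β : ℝ, 0 < β ∧ β ≤ 1 ∧ ∃ E : ℕ → Set Ω, (∀ n, MeasurableSet (E n)) ∧
      Pairwise (fun m n => Disjoint (E m) (E n)) ∧ (∀ n, 0 < μ (E n)) ∧
      ∀ n, ∀ t ∈ E n, β ^ |h t| ≤ μ.real (E n) := by
  obtain ⟨a, ha, hlarge⟩ : ∃ a : ℝ, 1 < a ∧ ∀ S : ℝ, ∃ s : ℝ, S ≤ s ∧
      a ^ (-s) < μ.real {t | s ≤ |h t|} := by
    by_contra! hcon
    refine H (hasExpTail_of_large fun a ha => ?_)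
    obtain ⟨S, hS⟩ := hcon a ha
    exact ⟨1, S, fun s hs => by rw [one_mul]; exact hS s hs⟩
  have ha0 : 0 < a := one_pos.trans ha
  -- The condition `1 ≤ s` is kept so that the factor `1/2` can be absorbed as `2 ^ (-s)`.
  have hstep : ∀ u : {s : ℝ // 1 ≤ s ∧ a ^ (-s) < μ.real {t | s ≤ |h t|}},
      ∃ v : {s : ℝ // 1 ≤ s ∧ a ^ (-s) < μ.real {t | s ≤ |h t|}},
        u.1 < v.1 ∧ μ.real {t | v.1 ≤ |h t|} ≤ μ.real {t | u.1 ≤ |h t|} / 2 := by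
    rintro ⟨u, hu1, hu⟩
    have hG : 0 < μ.real {t | u ≤ |h t|} := lt_trans (by positivity) hu
    obtain ⟨S, hS⟩ := eventually_atTop.1
      ((tendsto_measureReal_tail (μ := μ) hm).eventually_lt_const (half_pos hG))
    obtain ⟨v, hv, hva⟩ := hlarge (max S (u + 1))
    have h1 : S ≤ v := (le_max_left _ _).trans hv
    have h2 : u + 1 ≤ v := (le_max_right _ _).trans hv
    exact ⟨⟨v, by linarith, hva⟩, by simp only; linarith, (hS v h1).le⟩
  choose next hnext hhalf using hstep
  obtain ⟨s₀, hs₀, hs₀a⟩ := hlarge 1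
  set u : ℕ → {s : ℝ // 1 ≤ s ∧ a ^ (-s) < μ.real {t | s ≤ |h t|}} :=
    fun n => next^[n] ⟨s₀, hs₀, hs₀a⟩ with hu
  have hsucc : ∀ n, u (n + 1) = next (u n) := fun n => Function.iterate_succ_apply' _ _ _
  have hmono : StrictMono fun n => (u n).1 := strictMono_nat_of_lt_succ fun n => by
    rw [hsucc]; exact hnext _
  have hms : ∀ n, MeasurableSet {t | (u n).1 ≤ |h t|} :=
    fun n => measurableSet_le measurable_const hm.abs
  have hEμ : ∀ n, a ^ (-(u n).1) / 2 ≤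
      μ.real ({t | (u n).1 ≤ |h t|} \ {t | (u (n + 1)).1 ≤ |h t|}) := by
    intro n
    have hsub : {t | (u (n + 1)).1 ≤ |h t|} ⊆ {t | (u n).1 ≤ |h t|} :=
      (setOf_le_abs_subset h (hmono n.lt_succ_self)).trans (setOf_lt_abs_subset h _)
    rw [measureReal_sdiff hsub (hms _)]
    have h1 := hhalf (u n)
    rw [← hsucc] at h1
    linarith [(u n).2.2]
  refine ⟨(2 * a)⁻¹, by positivity, inv_le_one_of_one_le₀ (by linarith),
    fun n => {t | (u n).1 ≤ |h t|} \ {t | (u (n + 1)).1 ≤ |h t|},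
    fun n => (hms n).diff (hms _), ?_, fun n => ?_, fun n t ht => ?_⟩
  · refine (pairwise_disjoint_on _).2 fun m n hmn => ?_
    refine disjoint_left.2 fun t htm htn => htm.2 ?_
    have h1 : (u n).1 ≤ |h t| := htn.1
    exact (hmono.monotone (Nat.succ_le_of_lt hmn)).trans h1
  · have h1 := hEμ n
    have h2 : 0 < a ^ (-(u n).1) / 2 := by positivity
    exact (ENNReal.toReal_pos_iff.1 (h2.trans_le h1)).1
  · refine le_trans ?_ (hEμ n)
    have h1 : (u n).1 ≤ |h t| := ht.1
    have h2 : (2 : ℝ) ^ (1 : ℝ) ≤ 2 ^ (u n).1 :=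
      Real.rpow_le_rpow_of_exponent_le one_le_two (u n).2.1
    rw [Real.rpow_one] at h2
    calc (2 * a)⁻¹ ^ |h t| ≤ (2 * a)⁻¹ ^ (u n).1 :=
          Real.rpow_le_rpow_of_exponent_ge (by positivity)
            (inv_le_one_of_one_le₀ (by linarith)) h1
      _ = a ^ (-(u n).1) / 2 ^ (u n).1 := by
          rw [Real.inv_rpow (by positivity), Real.mul_rpow two_pos.le ha0.le,
            Real.rpow_neg ha0.le, mul_inv, mul_comm, div_eq_mul_inv]
      _ ≤ _ := by gcongr

variable {p q : VarExponent Ω}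

/-- Raise the hypothesis to the power `1/h = 1 - q/p` and divide by `m`. -/
theorem mul_inv_le_charFun_rpow {m β : ℝ} {t : Ω} (hm : 0 < m) (hβ : 0 ≤ β) (hqp : q t < p t)
    (h : β ^ |gapExponent p q t| ≤ m) : β * m⁻¹ ≤ (1 / m ^ (1 / p t)) ^ q t := by
  have hp := p.pos t
  have hg : 0 < gapExponent p q t := one_pos.trans_le (one_le_gapExponent hqp)
  rw [abs_of_pos hg] at h
  have h1 : β ≤ m ^ (1 - q t / p t) := by
    calc β = (β ^ gapExponent p q t) ^ (gapExponent p q t)⁻¹ := by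
          rw [← Real.rpow_mul hβ, mul_inv_cancel₀ hg.ne', Real.rpow_one]
      _ ≤ m ^ (gapExponent p q t)⁻¹ := Real.rpow_le_rpow (by positivity) h (by positivity)
      _ = _ := by
          rw [gapExponent, inv_div]
          congr 1
          field_simp
  calc β * m⁻¹ ≤ m ^ (1 - q t / p t) * m⁻¹ := by gcongr
    _ = (1 / m ^ (1 / p t)) ^ q t := by
        rw [Real.div_rpow zero_le_one (by positivity), Real.one_rpow, ← Real.rpow_mul hm.le,
          one_div (m ^ _), ← Real.rpow_neg hm.le, ← Real.rpow_neg_one, ← Real.rpow_add hm]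
        congr 1
        ring

/-- `f` is, on each `E n`, a multiple of the `n`-th normalized characteristic function, and
vanishes off `⋃ n, E n`. -/
def IsBlockCombination (p : VarExponent Ω) (μ : Measure Ω) (E : ℕ → Set Ω) (c : ℕ → ℝ)
    (f : Ω → ℝ) : Prop :=
  ∀ᵐ t ∂μ, (∀ n, t ∈ E n → f t = c n * (1 / μ.real (E n) ^ (1 / p t))) ∧
    ((∀ n, t ∉ E n) → f t = 0)

theorem exists_isBlockCombination {E : ℕ → Set Ω} (hE : ∀ n, MeasurableSet (E n))
    (hd : Pairwise fun m n => Disjoint (E m) (E n)) {f : VLp p μ}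
    (hf : f ∈ Submodule.span ℝ (range fun n => VLp.charFun p μ (E n) (hE n))) :
    ∃ c, IsBlockCombination p μ E c f := by
  induction hf using Submodule.span_induction with
  | mem x hx =>
    obtain ⟨k, rfl⟩ := hx
    refine ⟨fun n => if n = k then 1 else 0, ?_⟩
    filter_upwards [VLp.coeFn_mk _ _ (memVLp_charFun p μ (E k))] with t ht
    refine ⟨fun n hn => ht.trans ?_, fun hn => ht.trans (indicator_of_notMem (hn k) _)⟩
    by_cases hnk : n = k
    · subst hnk
      rw [indicator_of_mem hn, if_pos rfl, one_mul]
    · rw [indicator_of_notMem (disjoint_left.1 (hd hnk) hn), if_neg hnk, zero_mul]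
  | zero =>
    refine ⟨fun _ => 0, ?_⟩
    filter_upwards [VLp.coeFn_zero (p := p) (μ := μ)] with t ht
    exact ⟨fun n _ => by rw [ht, zero_mul], fun _ => ht⟩
  | add x y _ _ hx hy =>
    obtain ⟨c, hc⟩ := hx
    obtain ⟨d, hd'⟩ := hy
    refine ⟨fun n => c n + d n, ?_⟩
    filter_upwards [VLp.coeFn_add x y, hc, hd'] with t ht h1 h2
    refine ⟨fun n hn => ?_, fun hn => ?_⟩
    · rw [ht, h1.1 n hn, h2.1 n hn, add_mul]
    · rw [ht, h1.2 hn, h2.2 hn, add_zero]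
  | smul a x _ hx =>
    obtain ⟨c, hc⟩ := hx
    refine ⟨fun n => a * c n, ?_⟩
    filter_upwards [VLp.coeFn_smul a x, hc] with t ht h1
    refine ⟨fun n hn => ?_, fun hn => ?_⟩
    · rw [ht, h1.1 n hn, mul_assoc]
    · rw [ht, h1.2 hn, mul_zero]

/-- A block with `|c n| ≥ 1` contributes at least `β` alone. If all `|c n| < 1`, then `|c n| ^ q ≥
|c n| ^ p`, so `|f| ^ q ≥ β |f| ^ p` pointwise. -/
theorem IsBlockCombination.le_modular (hqp : ∀ᵐ t ∂μ, q t < p t) {E : ℕ → Set Ω}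
    (hE : ∀ n, MeasurableSet (E n)) (hE0 : ∀ n, 0 < μ (E n)) {β : ℝ} (hβ : 0 ≤ β)
    (hEβ : ∀ n, ∀ t ∈ E n, β ^ |gapExponent p q t| ≤ μ.real (E n)) {c : ℕ → ℝ} {f : Ω → ℝ}
    (hf : IsBlockCombination p μ E c f) (h1 : 1 ≤ modular p μ f) :
    ENNReal.ofReal β ≤ modular q μ f := by
  have hE' : ∀ n, 0 < μ.real (E n) := fun n => ENNReal.toReal_pos (hE0 n).ne' (measure_ne_top _ _)
  by_cases hc : ∃ n, 1 ≤ |c n|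
  · obtain ⟨n, hn⟩ := hc
    calc ENNReal.ofReal β = ∫⁻ _ in E n, ENNReal.ofReal (β * (μ.real (E n))⁻¹) ∂μ := by
          rw [setLIntegral_const, ← ofReal_measureReal, ← ENNReal.ofReal_mul
            (mul_nonneg hβ (inv_nonneg.2 (hE' n).le)), inv_mul_cancel_right₀ (hE' n).ne']
      _ ≤ ∫⁻ t in E n, ENNReal.ofReal (|f t| ^ q t) ∂μ := by
          refine lintegral_mono_ae ((ae_restrict_iff' (hE n)).2 ?_)
          filter_upwards [hqp, hf] with t ht hft htn
          refine ENNReal.ofReal_le_ofReal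
            ((mul_inv_le_charFun_rpow (hE' n) hβ ht (hEβ n t htn)).trans ?_)
          have h2 : 0 ≤ 1 / μ.real (E n) ^ (1 / p t) := by positivity
          refine Real.rpow_le_rpow h2 ?_ (q.pos t).le
          rw [hft.1 n htn, abs_mul, abs_of_nonneg h2]
          exact le_mul_of_one_le_left h2 hn
      _ ≤ modular q μ f := setLIntegral_le_lintegral _ _
  · push Not at hc
    calc ENNReal.ofReal β = ENNReal.ofReal β * 1 := (mul_one _).symm
      _ ≤ ENNReal.ofReal β * modular p μ f := by gcongr
      _ = ∫⁻ t, ENNReal.ofReal β * ENNReal.ofReal (|f t| ^ p t) ∂μ :=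
          (lintegral_const_mul' _ _ ENNReal.ofReal_ne_top).symm
      _ ≤ modular q μ f := by
          refine lintegral_mono_ae ?_
          filter_upwards [hqp, hf] with t ht hft
          rw [← ENNReal.ofReal_mul hβ]
          refine ENNReal.ofReal_le_ofReal ?_
          by_cases hex : ∃ n, t ∈ E n
          · obtain ⟨n, htn⟩ := hex
            have h2 : 0 ≤ 1 / μ.real (E n) ^ (1 / p t) := by positivity
            have h3 : (1 / μ.real (E n) ^ (1 / p t)) ^ p t = (μ.real (E n))⁻¹ := by
              rw [Real.div_rpow zero_le_one (by positivity), Real.one_rpow,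
                ← Real.rpow_mul (by positivity), one_div_mul_cancel (p.pos t).ne',
                Real.rpow_one, one_div]
            rw [hft.1 n htn, abs_mul, abs_of_nonneg h2, Real.mul_rpow (abs_nonneg _) h2,
              Real.mul_rpow (abs_nonneg _) h2, h3, mul_left_comm]
            refine mul_le_mul ?_ (mul_inv_le_charFun_rpow (hE' n) hβ ht (hEβ n t htn))
              (by positivity) (by positivity)
            exact Real.rpow_le_rpow_of_exponent_ge' (abs_nonneg _) (hc n).le (q.pos t).le ht.le
          · push Not at hex
            rw [hft.2 hex, abs_zero, Real.zero_rpow (p.pos t).ne', Real.zero_rpow (q.pos t).ne',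
              mul_zero]

/-- The modular estimate handles norms above `1` in the algebraic span; homogeneity removes the
normalization, and the inequality is a closed condition. -/
theorem isIsomorphismOn_closedSpan_charFun (hqp : ∀ᵐ t ∂μ, q t < p t) {E : ℕ → Set Ω}
    (hE : ∀ n, MeasurableSet (E n)) (hd : Pairwise fun m n => Disjoint (E m) (E n))
    (hE0 : ∀ n, 0 < μ (E n)) {β : ℝ} (hβ : 0 < β) (hβ1 : β ≤ 1)
    (hEβ : ∀ n, ∀ t ∈ E n, β ^ |gapExponent p q t| ≤ μ.real (E n)) :
    IsIsomorphismOn (VLp.inclusion (VarExponent.ae_le_of_ae_lt hqp))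
      (closedSpan fun n => VLp.charFun p μ (E n) (hE n)) := by
  set T := VLp.inclusion (VarExponent.ae_le_of_ae_lt hqp) with hT
  set V := Submodule.span ℝ (range fun n => VLp.charFun p μ (E n) (hE n)) with hV
  have h1 : ∀ f ∈ V, 1 < ‖f‖ → β ≤ ‖T f‖ := by
    intro f hf hf1
    obtain ⟨c, hc⟩ := exists_isBlockCombination hE hd hf
    have h2 : 1 ≤ modular p μ f := by
      by_contra! hlt
      exact absurd (luxNorm_le one_pos (by simpa using hlt.le)) (not_le.2 hf1)
    exact le_luxNorm (T f).memVLp hβ1 (hc.le_modular hqp hE hE0 hβ.le hEβ h2)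
  have h2 : ∀ f ∈ V, β * ‖f‖ ≤ ‖T f‖ := by
    intro f hf
    by_contra! hlt
    rw [mul_comm, ← div_lt_iff₀ hβ] at hlt
    -- With `‖T f‖ / β < r < ‖f‖`, the vector `f / r` has norm above `1` but image norm below `β`.
    obtain ⟨r, hr, hrf⟩ := exists_between hlt
    have hr0 : 0 < r := lt_of_le_of_lt (by positivity) hr
    have h3 := h1 (r⁻¹ • f) (V.smul_mem _ hf) (by
      rw [norm_smul, Real.norm_of_nonneg (by positivity), ← div_eq_inv_mul, one_lt_div hr0]
      exact hrf)
    rw [map_smul, norm_smul, Real.norm_of_nonneg (by positivity), ← div_eq_inv_mul,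
      le_div_iff₀ hr0] at h3
    rw [div_lt_iff₀ hβ] at hr
    linarith
  refine ⟨β, hβ, fun f hf => ?_⟩
  have hcl : IsClosed {f : VLp p μ | β * ‖f‖ ≤ ‖T f‖} :=
    isClosed_le (continuous_const.mul continuous_norm) T.continuous.norm
  exact closure_minimal (fun f hf => h2 f hf) hcl hf

end LowerEstimate

/-! ### The cycle of implications. -/

theorem theorem4p1 {Ω : Type*} [MeasurableSpace Ω] (μ : Measure Ω) [IsFiniteMeasure μ]
    (hμ : Atomless μ) (p q : VarExponent Ω) (hqp : ∀ᵐ t ∂μ, q t < p t) (hq : q.plus μ < ∞) :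
    List.TFAE [
      ∀ a : ℝ, 1 < a →
        ∫⁻ x in Ioo 0 (μ.real univ),
          ENNReal.ofReal (a ^ decRearr μ (fun t => p t / (p t - q t)) x) < ∞,
      IsLWeaklyCompact (VLp.inclusion (VarExponent.ae_le_of_ae_lt hqp)),
      IsMWeaklyCompact (VLp.inclusion (VarExponent.ae_le_of_ae_lt hqp)),
      IsDSS (VLp.inclusion (VarExponent.ae_le_of_ae_lt hqp)),
      ∀ (E : ℕ → Set Ω) (hE : ∀ n, MeasurableSet (E n)),
        Pairwise (fun m n => Disjoint (E m) (E n)) → (∀ n, 0 < μ (E n)) →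
        ¬ IsIsomorphismOn (VLp.inclusion (VarExponent.ae_le_of_ae_lt hqp))
          (closedSpan fun n => VLp.charFun p μ (E n) (hE n)),
      Tendsto (fun x : ℝ => (μ.real univ - x) ^ decRearr μ (fun t => (p t - q t) / p t) x)
        (𝓝[Ico 0 (μ.real univ)] μ.real univ) (𝓝 0)] := by
  have hgap : (fun t => p t / (p t - q t)) = gapExponent p q := rfl
  have hgap' : (fun t => (p t - q t) / p t) = fun t => (gapExponent p q t)⁻¹ := by
    funext t
    rw [gapExponent, inv_div]
  have hm : Measurable (gapExponent p q) := measurable_gapExponent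
  rw [hgap, hgap']
  tfae_have 1 → 2 := fun H =>
    (hasExpTail_of_lintegral_decRearr hm H).isLWeaklyCompact_inclusion hqp hq
  tfae_have 2 → 3 := IsLWeaklyCompact.isMWeaklyCompact (VLp.toAEEqFun_inclusion _)
  tfae_have 3 → 4 := IsMWeaklyCompact.isDSS
  tfae_have 4 → 5 := fun H E hE hd hE0 =>
    H _ (disjointSeq_charFun hE hd) fun n => VLp.norm_charFun (hE n) (hE0 n)
  tfae_have 5 → 6 := by
    intro H
    refine HasExpTail.tendsto_rpow_decRearr_inv hm ?_ ?_
    · filter_upwards [hqp] with t ht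
      exact (one_le_gapExponent ht).trans (le_abs_self _)
    · by_contra hcon
      obtain ⟨β, hβ, hβ1, E, hE, hd, hE0, hEβ⟩ := exists_disjoint_sets_of_not_hasExpTail hm hcon
      exact H E hE hd hE0 (isIsomorphismOn_closedSpan_charFun hqp hE hd hE0 hβ hβ1 hEβ)
  tfae_have 6 → 1 := fun H a ha =>
    (hasExpTail_of_tendsto_rpow_decRearr_inv hm H).lintegral_decRearr_lt_top ha
  tfae_finish
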